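/- Let $R>0$ and $D=\{x\in\mathbb R^2:|x|<R\}$. Let $J_n$ ($n=0,1,2,\dots$) be the Bessel functions of the first kind. Fix a boundary condition and let $\alpha_{nk}$ ($k=1,2,3,\dots$) be, in increasing order, the positive zeros of $J_n(z)$ (Dirichlet), of $J_n'(z)$ (Neumann), or, for a fixed $h>0$, of $\frac{z}{R}J_n'(z)+hJ_n(z)$ (Robin condition $\partial u/\partial r+hu=0$ on $|x|=R$); the zeros of $J_n'(z)+hJ_n(z)$, with $h>0$ fixed, are allowed as well (Robin condition normalized in the variable $z=\alpha_{nk}r/R$). For every $n\ge 0$ and $k\ge 1$ let $$u_{nk}(r,\varphi)=J_n(\alpha_{nk}r/R)\,\bigl(a_{nk}\cos(n\varphi)+b_{nk}\sin(n\varphi)\bigr)$$ with arbitrary real coefficients $a_{nk},b_{nk}$, not both zero (and $a_{0k}\neq 0$ when $n=0$). Let $1\le p\le\infty$, and let $V\subset D$ be open with $\overline V\cap\partial D=\emptyset$. Then $0<\|u_{nk}\|_{L_p(D)}<\infty$ for all $n\ge 0$, $k\ge 1$, and for every fixed $k\ge 1$ $$\lim_{n\to\infty}\frac{\|u_{nk}\|_{L_p(V)}}{\|u_{nk}\|_{L_p(D)}}=0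 .$$ Consequently $$\inf_{n\ge 0,\;k\ge 1}\frac{\|u_{nk}\|_{L_p(V)}}{\|u_{nk}\|_{L_p(D)}}=0,$$ and, in particular, the infimum $C_p(V)$ of this ratio over all the eigenfunctions above (all $n\ge 0$, $k\ge 1$ and all admissible coefficients) is $0$. -/

import Mathlib

open MeasureTheory Filter Topology
open scoped ENNReal

noncomputable section

namespace DiskModes

/-- The Bessel function of the first kind of integer order `n ≥ 0` on the real line,
`J_n(z) = ∑ₘ (-1)^m / (m! (m+n)!) (z/2)^(2m+n)`. -/
def besselJ (n : ℕ) (z : ℝ) : ℝ :=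
  ∑' m : ℕ, (-1 : ℝ) ^ m / ((m.factorial : ℝ) * ((m + n).factorial : ℝ)) * (z / 2) ^ (2 * m + n)

/-- The boundary conditions on the circle `|x| = R`. The Robin parameter enters in two
normalizations: `robin h` is `∂u/∂r + h u = 0` in the variable `r` itself, and
`robinUnscaled h` is the condition `J_n'(z) + h J_n(z) = 0` on the argument of the Bessel
function. -/
inductive BoundaryCondition : Type
  | dirichlet : BoundaryCondition
  | neumann : BoundaryCondition
  | robin (h : ℝ) (hpos : 0 < h) : BoundaryCondition
  | robinUnscaled (h : ℝ) (hpos : 0 < h) : BoundaryCondition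

/-- The function whose positive zeros `α` are those for which `J_n(α r / R)` satisfies the
boundary condition at `r = R`. -/
def BoundaryCondition.charFun (bc : BoundaryCondition) (R : ℝ) (n : ℕ) (z : ℝ) : ℝ :=
  match bc with
  | .dirichlet => besselJ n z
  | .neumann => deriv (besselJ n) z
  | .robin h _ => z / R * deriv (besselJ n) z + h * besselJ n z
  | .robinUnscaled h _ => deriv (besselJ n) z + h * besselJ n z

/-- For `k = 1, 2, 3, …` the `k`-th positive zero of `f` in increasing order: the first zero is
the least zero `> 0`, and the `(k+1)`-st is the least zero larger than the `k`-th. (The value `0`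
at `k = 0` only starts the recursion.) -/
def posZero (f : ℝ → ℝ) : ℕ → ℝ
  | 0 => 0
  | k + 1 => sInf {z : ℝ | posZero f k < z ∧ f z = 0}

/-- `α_{nk}`, the `k`-th positive zero belonging to the order `n` (`k ≥ 1`). -/
def alpha (bc : BoundaryCondition) (R : ℝ) (n k : ℕ) : ℝ :=
  posZero (bc.charFun R n) k

/-- The eigenfunction `J_n(α_{nk} r / R) (a cos(nφ) + b sin(nφ))` in polar coordinates
`x = r e^{iφ}`; the plane `ℝ²` is identified with `ℂ`. -/
def mode (bc : BoundaryCondition) (R : ℝ) (n k : ℕ) (a b : ℝ) (x : ℂ) : ℝ :=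
  besselJ n (alpha bc R n k * ‖x‖ / R) *
    (a * Real.cos (n * Complex.arg x) + b * Real.sin (n * Complex.arg x))

/-- The linear combination `a cos(nφ) + b sin(nφ)` is nontrivial
(for `n = 0` the sine is absent). -/
def Nontriv (n : ℕ) (a b : ℝ) : Prop :=
  a ≠ 0 ∨ (n ≠ 0 ∧ b ≠ 0)

/-- The norm `‖u‖_{L_p(A)}` with respect to Lebesgue measure in the plane (`p = ∞` allowed). -/
def lpNormOn (p : ℝ≥0∞) (A : Set ℂ) (u : ℂ → ℝ) : ℝ≥0∞ :=
  eLpNorm u p (volume.restrict A)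

/-- The open disk of radius `R`. -/
def disk (R : ℝ) : Set ℂ := Metric.ball 0 R

/-- The ratio `‖u‖_{L_p(V)} / ‖u‖_{L_p(D)}`. -/
def ratio (p : ℝ≥0∞) (R : ℝ) (V : Set ℂ) (u : ℂ → ℝ) : ℝ≥0∞ :=
  lpNormOn p V u / lpNormOn p (disk R) u

/-- `C_p(V)`: the infimum of the ratio over all eigenfunctions, i.e. over all `n ≥ 0`, `k ≥ 1`
and all nontrivial linear combinations. -/
def Cp (bc : BoundaryCondition) (p : ℝ≥0∞) (R : ℝ) (V : Set ℂ) : ℝ≥0∞ :=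
  sInf {c | ∃ (n k : ℕ) (a b : ℝ), 1 ≤ k ∧ Nontriv n a b ∧ c = ratio p R V (mode bc R n k a b)}

end DiskModes

end

namespace DiskModes

/-- Taylor coefficients of the entire function `besselG n`. -/
noncomputable def besselCoeff (n m : ℕ) : ℝ :=
  (-1 : ℝ) ^ m / ((m.factorial : ℝ) * ((m + n).factorial : ℝ))

/-- The entire function with `J_n(z) = (z/2)^n G_n((z/2)^2)`. -/
noncomputable def besselG (n : ℕ) (w : ℝ) : ℝ := ∑' m : ℕ, besselCoeff n m * w ^ m

lemma abs_besselCoeff_le (n m : ℕ) : |besselCoeff n m| ≤ 1 / (m.factorial : ℝ) := by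
  have h1 : (1 : ℝ) ≤ ((m + n).factorial : ℝ) := by
    exact_mod_cast Nat.one_le_iff_ne_zero.mpr (Nat.factorial_ne_zero _)
  have h2 : (0 : ℝ) < (m.factorial : ℝ) := by exact_mod_cast Nat.factorial_pos _
  rw [besselCoeff, abs_div, abs_pow, abs_neg, abs_one, one_pow, abs_of_pos (by positivity)]
  apply one_div_le_one_div_of_le h2
  nlinarith

lemma summable_besselG (n : ℕ) (w : ℝ) : Summable fun m : ℕ => besselCoeff n m * w ^ m := by
  refine Summable.of_norm_bounded (Real.summable_pow_div_factorial |w|) fun m => ?_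
  rw [Real.norm_eq_abs, abs_mul, abs_pow]
  calc _ ≤ 1 / (m.factorial : ℝ) * |w| ^ m := by
        gcongr
        exact abs_besselCoeff_le n m
    _ = _ := by ring

lemma besselCoeff_succ_mul (n m : ℕ) :
    besselCoeff n (m + 1) * ((m : ℝ) + 1) = - besselCoeff (n + 1) m := by
  have h2 : (m.factorial : ℝ) ≠ 0 := by exact_mod_cast Nat.factorial_ne_zero _
  have h3 : ((m + (n + 1)).factorial : ℝ) ≠ 0 := by exact_mod_cast Nat.factorial_ne_zero _
  have h4 : (m : ℝ) + 1 ≠ 0 := by positivity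
  rw [besselCoeff, besselCoeff, show m + 1 + n = m + (n + 1) by ring, Nat.factorial_succ]
  push_cast
  field_simp
  ring

lemma besselCoeff_eq_succ (n m : ℕ) :
    besselCoeff n m = ((n : ℝ) + 1) * besselCoeff (n + 1) m + m * besselCoeff (n + 1) m := by
  have h2 : (m.factorial : ℝ) ≠ 0 := by exact_mod_cast Nat.factorial_ne_zero _
  have h3 : ((m + n).factorial : ℝ) ≠ 0 := by exact_mod_cast Nat.factorial_ne_zero _
  have h4 : (m : ℝ) + n + 1 ≠ 0 := by positivity
  rw [besselCoeff, besselCoeff, ← add_assoc, Nat.factorial_succ]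
  push_cast
  field_simp
  ring

lemma hasDerivAt_besselG (n : ℕ) (w : ℝ) : HasDerivAt (besselG n) (-besselG (n + 1) w) w := by
  set r : ℝ := |w| + 1
  have hr : 0 < r := by positivity
  have hu : Summable fun m : ℕ => (m : ℝ) * r ^ (m - 1) / (m.factorial : ℝ) := by
    rw [← summable_nat_add_iff 1]
    refine (Real.summable_pow_div_factorial r).congr fun m => ?_
    have h2 : (m.factorial : ℝ) ≠ 0 := by exact_mod_cast Nat.factorial_ne_zero _
    have h4 : (m : ℝ) + 1 ≠ 0 := by positivity
    rw [Nat.factorial_succ, Nat.add_sub_cancel]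
    push_cast
    field_simp
  have key := hasDerivAt_tsum_of_isPreconnected (t := Metric.ball (0 : ℝ) r)
    (g := fun m x => besselCoeff n m * x ^ m)
    (g' := fun m x => besselCoeff n m * (m * x ^ (m - 1))) (y₀ := w) (y := w) hu
    Metric.isOpen_ball (convex_ball _ _).isPreconnected
    (fun m x _ => (hasDerivAt_pow m x).const_mul _)
    (fun m x hx => by
      have hx' : |x| ≤ r := by simpa using (Metric.mem_ball.mp hx).le
      rw [Real.norm_eq_abs, abs_mul, abs_mul, abs_pow, Nat.abs_cast]
      calc _ ≤ 1 / (m.factorial : ℝ) * (m * r ^ (m - 1)) := by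
            gcongr
            exact abs_besselCoeff_le n m
        _ = _ := by ring)
    (by simp [r]) (summable_besselG n w) (by simp [r])
  have hs : Summable fun m : ℕ => besselCoeff n m * (m * w ^ (m - 1)) := by
    rw [← summable_nat_add_iff 1]
    refine (summable_besselG (n + 1) w).neg.congr fun m => ?_
    have := besselCoeff_succ_mul n m
    rw [Nat.add_sub_cancel]
    push_cast
    linear_combination (-w ^ m) * this
  refine HasDerivAt.congr_deriv key ?_
  rw [hs.tsum_eq_zero_add, besselG, ← tsum_neg]
  simp only [Nat.cast_zero, zero_mul, mul_zero, zero_add]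
  refine tsum_congr fun m => ?_
  have := besselCoeff_succ_mul n m
  rw [Nat.add_sub_cancel]
  push_cast
  linear_combination (w ^ m) * this

lemma besselG_recurrence (n : ℕ) (w : ℝ) :
    besselG n w = (n + 1) * besselG (n + 1) w - w * besselG (n + 2) w := by
  have h1 : Summable fun m : ℕ => m * besselCoeff (n + 1) m * w ^ m := by
    rw [← summable_nat_add_iff 1]
    refine ((summable_besselG (n + 2) w).mul_left (-w)).congr fun m => ?_
    have := besselCoeff_succ_mul (n + 1) m
    push_cast
    linear_combination (-w ^ (m + 1)) * this
  have h2 : ∑' m : ℕ, m * besselCoeff (n + 1) m * w ^ m = -w * besselG (n + 2) w := by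
    rw [h1.tsum_eq_zero_add, besselG, ← tsum_mul_left]
    simp only [Nat.cast_zero, zero_mul, zero_add]
    refine tsum_congr fun m => ?_
    have := besselCoeff_succ_mul (n + 1) m
    push_cast
    linear_combination (w ^ (m + 1)) * this
  have h3 : besselG n w = (n + 1) * besselG (n + 1) w +
      ∑' m : ℕ, m * besselCoeff (n + 1) m * w ^ m := by
    rw [besselG, besselG, ← tsum_mul_left,
      ← ((summable_besselG (n + 1) w).mul_left _).tsum_add h1]
    refine tsum_congr fun m => ?_
    rw [besselCoeff_eq_succ n m]
    ring
  rw [h3, h2]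
  ring

lemma besselG_zero (n : ℕ) : besselG n 0 = 1 / (n.factorial : ℝ) := by
  rw [besselG, tsum_eq_single 0 (fun m hm => by simp [hm])]
  simp [besselCoeff]

lemma analyticAt_besselG (n : ℕ) (w : ℝ) : AnalyticAt ℝ (besselG n) w := by
  set q := FormalMultilinearSeries.ofScalars ℝ (besselCoeff n) with hq
  have hsum : q.sum = besselG n := by
    funext x
    rw [hq, ← FormalMultilinearSeries.ofScalarsSum, FormalMultilinearSeries.ofScalars_sum_eq]
    simp [besselG]
  have hrad : q.radius = ⊤ := by
    refine FormalMultilinearSeries.radius_eq_top_of_summable_norm _ fun r => ?_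
    refine Summable.of_nonneg_of_le (fun m => by positivity) (fun m => ?_)
      (Real.summable_pow_div_factorial r)
    rw [hq, FormalMultilinearSeries.ofScalars_norm, Real.norm_eq_abs]
    calc _ ≤ 1 / (m.factorial : ℝ) * (r : ℝ) ^ m := by
          gcongr
          exact abs_besselCoeff_le n m
      _ = _ := by ring
  have h := q.hasFPowerSeriesOnBall (by rw [hrad]; exact ENNReal.zero_lt_top)
  rw [hsum, hrad] at h
  exact h.analyticAt_of_mem (by simp)

lemma besselJ_eq (n : ℕ) (z : ℝ) : besselJ n z = (z / 2) ^ n * besselG n ((z / 2) ^ 2) := by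
  rw [besselJ, besselG, ← tsum_mul_left]
  refine tsum_congr fun m => ?_
  rw [besselCoeff, pow_add, pow_mul]
  ring

lemma analyticAt_besselJ (n : ℕ) (z : ℝ) : AnalyticAt ℝ (besselJ n) z := by
  have h : besselJ n = fun z => (z / 2) ^ n * besselG n ((z / 2) ^ 2) := funext (besselJ_eq n)
  rw [h]
  have h2 : AnalyticAt ℝ (fun z : ℝ => z / 2) z := by fun_prop
  exact (h2.pow n).mul ((analyticAt_besselG n _).comp_of_eq (h2.pow 2) rfl)

lemma differentiable_besselJ (n : ℕ) : Differentiable ℝ (besselJ n) :=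
  fun z => (analyticAt_besselJ n z).differentiableAt

lemma continuous_besselJ (n : ℕ) : Continuous (besselJ n) := (differentiable_besselJ n).continuous

lemma hasDerivAt_besselG_comp (n : ℕ) (z : ℝ) :
    HasDerivAt (fun z => besselG n ((z / 2) ^ 2)) (-(z / 2) * besselG (n + 1) ((z / 2) ^ 2)) z := by
  have h1 : HasDerivAt (fun z : ℝ => (z / 2) ^ 2) (z / 2) z := by
    refine (((hasDerivAt_id z).div_const 2).pow 2).congr_deriv ?_
    simp
    ring
  have h := (hasDerivAt_besselG n ((z / 2) ^ 2)).comp z h1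
  refine h.congr_deriv ?_
  ring

lemma hasDerivAt_half_pow (n : ℕ) (z : ℝ) :
    HasDerivAt (fun z : ℝ => (z / 2) ^ n) (n * (z / 2) ^ (n - 1) / 2) z := by
  refine (((hasDerivAt_id z).div_const 2).pow n).congr_deriv ?_
  simp
  ring

/-- `z J_n' = n J_n - z J_{n+1}`. -/
lemma mul_deriv_besselJ (n : ℕ) (z : ℝ) :
    z * deriv (besselJ n) z = n * besselJ n z - z * besselJ (n + 1) z := by
  have h := (hasDerivAt_half_pow n z).mul (hasDerivAt_besselG_comp n z)
  have h' : besselJ n = (fun z : ℝ => (z / 2) ^ n) * fun z => besselG n ((z / 2) ^ 2) :=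
    funext (besselJ_eq n)
  rw [h', h.deriv, ← h', besselJ_eq, besselJ_eq]
  rcases n with _ | n
  · simp
  · rw [Nat.add_sub_cancel]
    push_cast
    ring

/-- `(z J_{n+1})' = z J_n - n J_{n+1}`. -/
lemma hasDerivAt_mul_besselJ_succ (n : ℕ) (z : ℝ) :
    HasDerivAt (fun z => z * besselJ (n + 1) z) (z * besselJ n z - n * besselJ (n + 1) z) z := by
  have h := ((hasDerivAt_half_pow (n + 2) z).mul (hasDerivAt_besselG_comp (n + 1) z)).const_mul 2
  have h' : (fun z => z * besselJ (n + 1) z) =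
      fun z => 2 * ((fun z : ℝ => (z / 2) ^ (n + 2)) * fun z => besselG (n + 1) ((z / 2) ^ 2)) z := by
    funext x
    rw [besselJ_eq]
    simp only [Pi.mul_apply]
    ring
  rw [h']
  refine h.congr_deriv ?_
  rw [besselJ_eq, besselJ_eq, besselG_recurrence n]
  simp only [show n + 2 - 1 = n + 1 from rfl]
  push_cast
  ring

/-- The Euler derivative `z J_n'(z)`. -/
noncomputable def besselT (n : ℕ) (z : ℝ) : ℝ := n * besselJ n z - z * besselJ (n + 1) z

lemma hasDerivAt_besselJ (n : ℕ) {z : ℝ} (hz : z ≠ 0) :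
    HasDerivAt (besselJ n) (besselT n z / z) z := by
  have h := (differentiable_besselJ n z).hasDerivAt
  rwa [show deriv (besselJ n) z = besselT n z / z by
    rw [besselT, ← mul_deriv_besselJ]; field_simp] at h

/-- Bessel's equation. -/
lemma hasDerivAt_besselT (n : ℕ) {z : ℝ} (hz : z ≠ 0) :
    HasDerivAt (besselT n) (((n : ℝ) ^ 2 - z ^ 2) * besselJ n z / z) z := by
  have h := ((hasDerivAt_besselJ n hz).const_mul (n : ℝ)).sub (hasDerivAt_mul_besselJ_succ n z)
  refine h.congr_deriv ?_
  rw [besselT]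
  field_simp
  ring

lemma continuous_besselT (n : ℕ) : Continuous (besselT n) := by
  have := continuous_besselJ n
  have := continuous_besselJ (n + 1)
  unfold besselT
  fun_prop

/-- Sturm comparison with `sin (ω (t - t₀))`. -/
lemma not_forall_pos_of_oscillation {f g q : ℝ → ℝ} {t₀ ω : ℝ} (hω : 0 < ω)
    (hf : ∀ t, HasDerivAt f (g t) t) (hg : ∀ t, HasDerivAt g (-(q t) * f t) t)
    (hq : ∀ t, t₀ ≤ t → ω ^ 2 ≤ q t) :
    ¬ ∀ t ∈ Set.Icc t₀ (t₀ + Real.pi / ω), 0 < f t := by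
  intro hpos
  have hlt : t₀ < t₀ + Real.pi / ω := by have := Real.pi_pos; simp; positivity
  have hlin : ∀ t, HasDerivAt (fun t => ω * (t - t₀)) ω t := fun t => by
    simpa using ((hasDerivAt_id t).sub_const t₀).const_mul ω
  have hs : ∀ t, HasDerivAt (fun t => Real.sin (ω * (t - t₀)))
      (Real.cos (ω * (t - t₀)) * ω) t := fun t => (hlin t).sin
  have hc : ∀ t, HasDerivAt (fun t => Real.cos (ω * (t - t₀)))
      (-Real.sin (ω * (t - t₀)) * ω) t := fun t => (hlin t).cos
  have hW : ∀ t, HasDerivAt (fun t => g t * Real.sin (ω * (t - t₀)) -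
      f t * (Real.cos (ω * (t - t₀)) * ω))
      ((ω ^ 2 - q t) * (f t * Real.sin (ω * (t - t₀)))) t := fun t => by
    refine (((hg t).mul (hs t)).sub ((hf t).mul ((hc t).mul_const ω))).congr_deriv ?_
    ring
  have hanti : AntitoneOn (fun t => g t * Real.sin (ω * (t - t₀)) -
      f t * (Real.cos (ω * (t - t₀)) * ω)) (Set.Icc t₀ (t₀ + Real.pi / ω)) := by
    refine antitoneOn_of_deriv_nonpos (convex_Icc _ _)
      (fun t _ => (hW t).continuousAt.continuousWithinAt)
      (fun t _ => (hW t).differentiableAt.differentiableWithinAt) fun t ht => ?_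
    have ht' := interior_subset ht
    rw [(hW t).deriv]
    have h1 : 0 ≤ Real.sin (ω * (t - t₀)) := by
      refine Real.sin_nonneg_of_nonneg_of_le_pi
        (mul_nonneg hω.le (sub_nonneg.mpr ht'.1)) ?_
      have : t - t₀ ≤ Real.pi / ω := by linarith [ht'.2]
      rw [le_div_iff₀ hω] at this
      linarith
    exact mul_nonpos_of_nonpos_of_nonneg (sub_nonpos.mpr (hq t ht'.1))
      (mul_nonneg (hpos t ht').le h1)
  have h := hanti (Set.left_mem_Icc.mpr hlt.le) (Set.right_mem_Icc.mpr hlt.le) hlt.le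
  have e : ω * (t₀ + Real.pi / ω - t₀) = Real.pi := by field_simp; ring
  simp only [e, sub_self, mul_zero, Real.sin_zero, Real.cos_zero, Real.sin_pi, Real.cos_pi] at h
  have h1 := mul_pos (hpos _ (Set.left_mem_Icc.mpr hlt.le)) hω
  have h2 := mul_pos (hpos _ (Set.right_mem_Icc.mpr hlt.le)) hω
  linarith

lemma exists_besselJ_eq_zero (n : ℕ) {t₀ ω : ℝ} (hω : 0 < ω)
    (h : (n : ℝ) ^ 2 + ω ^ 2 ≤ Real.exp t₀ ^ 2) :
    ∃ t ∈ Set.Icc t₀ (t₀ + Real.pi / ω), besselJ n (Real.exp t) = 0 := by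
  have hf : ∀ t, HasDerivAt (fun t => besselJ n (Real.exp t)) (besselT n (Real.exp t)) t :=
    fun t => by
      refine ((hasDerivAt_besselJ n (Real.exp_ne_zero t)).comp t
        (Real.hasDerivAt_exp t)).congr_deriv ?_
      field_simp
  have hg : ∀ t, HasDerivAt (fun t => besselT n (Real.exp t))
      (-(Real.exp t ^ 2 - (n : ℝ) ^ 2) * besselJ n (Real.exp t)) t := fun t => by
    refine ((hasDerivAt_besselT n (Real.exp_ne_zero t)).comp t
      (Real.hasDerivAt_exp t)).congr_deriv ?_
    field_simp
    ring
  have hq : ∀ t, t₀ ≤ t → ω ^ 2 ≤ Real.exp t ^ 2 - (n : ℝ) ^ 2 := fun t ht => by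
    have : Real.exp t₀ ^ 2 ≤ Real.exp t ^ 2 := by gcongr
    linarith
  have hP := not_forall_pos_of_oscillation hω hf hg hq
  have hN := not_forall_pos_of_oscillation (f := fun t => -besselJ n (Real.exp t))
    (g := fun t => -besselT n (Real.exp t)) hω (fun t => (hf t).neg)
    (fun t => ((hg t).neg).congr_deriv (by ring)) hq
  push Not at hP hN
  obtain ⟨a, ha, ha'⟩ := hP
  obtain ⟨b, hb, hb'⟩ := hN
  obtain ⟨c, hc, hc'⟩ := isPreconnected_Icc.intermediate_value ha hb
    (f := fun t => besselJ n (Real.exp t))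
    (fun t _ => (hf t).continuousAt.continuousWithinAt) ⟨ha', by simpa using hb'⟩
  exact ⟨c, hc, hc'⟩

lemma eventually_besselJ_pos (n : ℕ) : ∀ᶠ z in 𝓝[>] (0 : ℝ), 0 < besselJ n z := by
  have hcont : ContinuousAt (fun z : ℝ => besselG n ((z / 2) ^ 2)) 0 :=
    (hasDerivAt_besselG_comp n 0).continuousAt
  have h0 : 0 < besselG n (((0 : ℝ) / 2) ^ 2) := by
    have : (0 : ℝ) < n.factorial := by exact_mod_cast Nat.factorial_pos _
    simp [besselG_zero, this]
  filter_upwards [nhdsWithin_le_nhds (hcont.eventually (lt_mem_nhds h0)), self_mem_nhdsWithin]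
    with z hz hz'
  rw [besselJ_eq]
  have hz'' : 0 < z := hz'
  positivity

/-- Apart from the Dirichlet case, the characteristic function is, up to nonvanishing factors,
the derivative of a positive multiple of `J_n`. -/
lemma exists_integrating_factor (bc : BoundaryCondition) {R : ℝ} (hR : 0 < R) (n : ℕ)
    (hbc : bc ≠ .dirichlet) : ∃ μ ν : ℝ → ℝ, ∀ z, 0 < z → μ z ≠ 0 ∧ ν z ≠ 0 ∧
      HasDerivAt (fun z => μ z * besselJ n z) (ν z * bc.charFun R n z) z := by
  have hJ : ∀ z, HasDerivAt (besselJ n) (deriv (besselJ n) z) z :=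
    fun z => (differentiable_besselJ n z).hasDerivAt
  cases bc with
  | dirichlet => exact absurd rfl hbc
  | neumann =>
    refine ⟨fun _ => 1, fun _ => 1, fun z hz => ⟨one_ne_zero, one_ne_zero, ?_⟩⟩
    simpa [BoundaryCondition.charFun] using hJ z
  | robin h hpos =>
    refine ⟨fun z => z ^ (h * R), fun z => R * z ^ (h * R - 1), fun z hz =>
      ⟨(Real.rpow_pos_of_pos hz _).ne', (mul_pos hR (Real.rpow_pos_of_pos hz _)).ne', ?_⟩⟩
    refine ((Real.hasDerivAt_rpow_const (p := h * R) (Or.inl hz.ne')).mul (hJ z)).congr_deriv ?_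
    simp only [BoundaryCondition.charFun]
    rw [show z ^ (h * R) = z * z ^ (h * R - 1) by
      rw [Real.rpow_sub_one hz.ne']; field_simp]
    field_simp
    ring
  | robinUnscaled h hpos =>
    refine ⟨fun z => Real.exp (h * z), fun z => Real.exp (h * z), fun z hz =>
      ⟨Real.exp_ne_zero _, Real.exp_ne_zero _, ?_⟩⟩
    have he : HasDerivAt (fun z => Real.exp (h * z)) (Real.exp (h * z) * h) z := by
      simpa using ((hasDerivAt_id z).const_mul h).exp
    refine (he.mul (hJ z)).congr_deriv ?_
    simp only [BoundaryCondition.charFun]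
    ring

lemma exists_charFun_eq_zero (bc : BoundaryCondition) {R : ℝ} (hR : 0 < R) (n : ℕ) {t₀ ω : ℝ}
    (hω : 0 < ω) (h : (n : ℝ) ^ 2 + ω ^ 2 ≤ Real.exp t₀ ^ 2) :
    ∃ t ∈ Set.Icc t₀ (t₀ + 3 * (Real.pi / ω)), bc.charFun R n (Real.exp t) = 0 := by
  have hδ : 0 < Real.pi / ω := div_pos Real.pi_pos hω
  set δ := Real.pi / ω
  obtain ⟨a, ha, ha'⟩ := exists_besselJ_eq_zero n hω h
  by_cases hbc : bc = .dirichlet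
  · subst hbc
    exact ⟨a, ⟨ha.1, by linarith [ha.2]⟩, ha'⟩
  have h2 : (n : ℝ) ^ 2 + ω ^ 2 ≤ Real.exp (t₀ + 2 * δ) ^ 2 := by
    refine h.trans ?_
    gcongr
    linarith
  obtain ⟨b, hb, hb'⟩ := exists_besselJ_eq_zero n hω h2
  obtain ⟨μ, ν, hμν⟩ := exists_integrating_factor bc hR n hbc
  have hab : Real.exp a < Real.exp b := Real.exp_lt_exp.mpr (by linarith [ha.2, hb.1])
  have hpos : ∀ z, Real.exp a ≤ z → 0 < z := fun z hz => (Real.exp_pos a).trans_le hz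
  obtain ⟨c, hc, hc'⟩ := exists_hasDerivAt_eq_zero (f := fun z => μ z * besselJ n z)
    (f' := fun z => ν z * bc.charFun R n z) hab
    (fun z hz => (hμν z (hpos z hz.1)).2.2.continuousAt.continuousWithinAt)
    (by simp [ha', hb']) (fun z hz => (hμν z (hpos z hz.1.le)).2.2)
  have hc0 := hpos c hc.1.le
  refine ⟨Real.log c, ⟨?_, ?_⟩, ?_⟩
  · exact ha.1.trans ((Real.lt_log_iff_exp_lt hc0).mpr hc.1).le
  · have := ((Real.log_lt_iff_lt_exp hc0).mpr hc.2).le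
    have := hb.2
    linarith
  · rw [Real.exp_log hc0]
    exact (mul_eq_zero.mp hc').resolve_left (hμν c hc0).2.1

lemma exists_large_exp (n : ℕ) (c : ℝ) :
    ∃ t₀ : ℝ, c < Real.exp t₀ ∧ (n : ℝ) ^ 2 + (1 : ℝ) ^ 2 ≤ Real.exp t₀ ^ 2 := by
  refine ⟨Real.log (|c| + n + 1), ?_, ?_⟩ <;> rw [Real.exp_log (by positivity)]
  · have := le_abs_self c
    have : (0 : ℝ) ≤ n := by positivity
    linarith
  · have : (0 : ℝ) ≤ n := by positivity
    have := abs_nonneg c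
    nlinarith

lemma exists_charFun_ne_zero (bc : BoundaryCondition) {R : ℝ} (hR : 0 < R) (n : ℕ) :
    ∃ z, bc.charFun R n z ≠ 0 := by
  obtain ⟨t₀, ht₁, ht₂⟩ := exists_large_exp n 1
  obtain ⟨b, hb, hb'⟩ := exists_besselJ_eq_zero n one_pos ht₂
  have hb1 : 1 < Real.exp b := ht₁.trans_le (Real.exp_le_exp.mpr hb.1)
  obtain ⟨a, ha, ha0, ha1⟩ := ((eventually_besselJ_pos n).and
    (Ioo_mem_nhdsGT (zero_lt_one' ℝ))).exists
  by_cases hbc : bc = .dirichlet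
  · subst hbc
    exact ⟨a, ha.ne'⟩
  obtain ⟨μ, ν, hμν⟩ := exists_integrating_factor bc hR n hbc
  obtain ⟨c, hc, hc'⟩ := exists_hasDerivAt_eq_slope (fun z => μ z * besselJ n z)
    (fun z => ν z * bc.charFun R n z) (ha1.trans hb1)
    (fun z hz => (hμν z (ha0.trans_le hz.1)).2.2.continuousAt.continuousWithinAt)
    (fun z hz => (hμν z (ha0.trans hz.1)).2.2)
  refine ⟨c, fun h => ?_⟩
  rw [h, hb', mul_zero, mul_zero, eq_comm, div_eq_zero_iff] at hc'
  rcases hc' with h1 | h1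
  · have := mul_ne_zero (hμν a ha0).1 ha.ne'
    exact this (by linarith)
  · linarith

lemma analyticAt_charFun (bc : BoundaryCondition) (R : ℝ) (n : ℕ) (z : ℝ) :
    AnalyticAt ℝ (bc.charFun R n) z := by
  have h1 := analyticAt_besselJ n z
  have h2 := h1.deriv
  cases bc with
  | dirichlet => exact h1
  | neumann => exact h2
  | robin h hpos =>
    have h3 : AnalyticAt ℝ (fun z : ℝ => z / R) z := by fun_prop
    exact (h3.mul h2).add (analyticAt_const.mul h1)
  | robinUnscaled h hpos => exact h2.add (analyticAt_const.mul h1)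

lemma eventually_charFun_ne_zero (bc : BoundaryCondition) {R : ℝ} (hR : 0 < R) (n : ℕ) (c : ℝ) :
    ∀ᶠ z in 𝓝[>] c, bc.charFun R n z ≠ 0 := by
  have hA : AnalyticOnNhd ℝ (bc.charFun R n) Set.univ := fun z _ => analyticAt_charFun bc R n z
  have hle : 𝓝[>] c ≤ 𝓝[≠] c := nhdsWithin_mono _ fun z hz => ne_of_gt hz
  refine hle ?_
  rcases (analyticAt_charFun bc R n c).eventually_eq_zero_or_eventually_ne_zero with h | h
  · obtain ⟨z, hz⟩ := exists_charFun_ne_zero bc hR n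
    exact absurd (hA.eqOn_zero_of_preconnected_of_eventuallyEq_zero isPreconnected_univ
      (Set.mem_univ c) h (Set.mem_univ z)) hz
  · exact h

lemma posZero_lt_succ {f : ℝ → ℝ} {k : ℕ} (h1 : ∀ c, ∀ᶠ z in 𝓝[>] c, f z ≠ 0)
    (h2 : ∀ c, ∃ z, c < z ∧ f z = 0) : posZero f k < posZero f (k + 1) := by
  obtain ⟨d, hd, hd'⟩ := (mem_nhdsGT_iff_exists_Ioo_subset).mp (h1 (posZero f k))
  refine lt_of_lt_of_le hd (le_csInf (h2 (posZero f k)) fun z hz => ?_)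
  by_contra hlt
  exact hd' ⟨hz.1, not_le.mp hlt⟩ hz.2

lemma alpha_pos (bc : BoundaryCondition) {R : ℝ} (hR : 0 < R) (n : ℕ) {k : ℕ} (hk : 1 ≤ k) :
    0 < alpha bc R n k := by
  have hmono : StrictMono (posZero (bc.charFun R n)) := by
    refine strictMono_nat_of_lt_succ fun k =>
      posZero_lt_succ (eventually_charFun_ne_zero bc hR n) fun c => ?_
    obtain ⟨t₀, ht₁, ht₂⟩ := exists_large_exp n c
    obtain ⟨t, ht, ht'⟩ := exists_charFun_eq_zero bc hR n one_pos ht₂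
    exact ⟨Real.exp t, ht₁.trans_le (Real.exp_le_exp.mpr ht.1), ht'⟩
  exact hmono (show 0 < k from hk)

lemma posZero_succ_le {f : ℝ → ℝ} {x : ℕ → ℝ} (h0 : 0 < x 0) (hx : ∀ i, x i < x (i + 1))
    (hf : ∀ i, f (x i) = 0) (i : ℕ) : posZero f (i + 1) ≤ x i := by
  induction i with
  | zero => exact csInf_le ⟨0, fun z hz => hz.1.le⟩ ⟨h0, hf 0⟩
  | succ i ih => exact csInf_le ⟨_, fun z hz => hz.1.le⟩ ⟨ih.trans_lt (hx i), hf _⟩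

lemma alpha_le (bc : BoundaryCondition) {R : ℝ} (hR : 0 < R) (n k : ℕ) (hk : 1 ≤ k) {t₀ ω : ℝ}
    (hω : 0 < ω) (h : (n : ℝ) ^ 2 + ω ^ 2 ≤ Real.exp t₀ ^ 2) :
    alpha bc R n k ≤ Real.exp (t₀ + 4 * k * (Real.pi / ω)) := by
  have hδ : 0 < Real.pi / ω := div_pos Real.pi_pos hω
  have hex : ∀ i : ℕ, ∃ t ∈ Set.Icc (t₀ + 4 * i * (Real.pi / ω))
      (t₀ + 4 * i * (Real.pi / ω) + 3 * (Real.pi / ω)), bc.charFun R n (Real.exp t) = 0 :=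
    fun i => exists_charFun_eq_zero bc hR n hω (h.trans (by
      have : 0 ≤ 4 * (i : ℝ) * (Real.pi / ω) := by positivity
      gcongr
      linarith))
  choose t ht ht' using hex
  obtain ⟨i, rfl⟩ : ∃ i, k = i + 1 := ⟨k - 1, by omega⟩
  refine (posZero_succ_le (x := fun i => Real.exp (t i)) (Real.exp_pos _) (fun i => ?_) ht' i).trans
    (Real.exp_le_exp.mpr ?_)
  · refine Real.exp_lt_exp.mpr ?_
    have h1 := (ht i).2
    have h2 := (ht (i + 1)).1
    push_cast at h2
    nlinarith
  · have h1 := (ht i).2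
    push_cast
    nlinarith

lemma eventually_alpha_le (bc : BoundaryCondition) {R : ℝ} (hR : 0 < R) (k : ℕ) (hk : 1 ≤ k)
    {A : ℝ} (hA : 1 < A) : ∀ᶠ n : ℕ in atTop, alpha bc R n k ≤ A * n := by
  obtain ⟨a, ha1, haA⟩ := exists_between hA
  have hη : 0 < Real.sqrt (a ^ 2 - 1) := Real.sqrt_pos.mpr (by nlinarith)
  set η := Real.sqrt (a ^ 2 - 1) with hηdef
  have hη2 : η ^ 2 = a ^ 2 - 1 := Real.sq_sqrt (by nlinarith)
  have hlim : Tendsto (fun n : ℕ => a * Real.exp (4 * k * (Real.pi / (η * n)))) atTop (𝓝 a) := by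
    have h1 : Tendsto (fun n : ℕ => 4 * (k : ℝ) * (Real.pi / (η * n))) atTop (𝓝 (4 * k * 0)) :=
      (tendsto_const_nhds.div_atTop
        (tendsto_natCast_atTop_atTop.const_mul_atTop hη)).const_mul _
    have h2 := ((Real.continuous_exp.tendsto _).comp h1).const_mul a
    simpa [Function.comp_def] using h2
  filter_upwards [hlim.eventually (gt_mem_nhds haA), eventually_ge_atTop 1] with n hn hn1
  have hn0 : (0 : ℝ) < n := by exact_mod_cast hn1
  have hexp : Real.exp (Real.log (a * n)) = a * n := Real.exp_log (by positivity)
  have h := alpha_le bc hR n k hk (t₀ := Real.log (a * n)) (ω := η * n) (by positivity)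
    (by rw [hexp, mul_pow, mul_pow, hη2]; ring_nf; rfl)
  rw [Real.exp_add, hexp] at h
  refine h.trans ?_
  nlinarith

lemma besselJ_apply_zero {n : ℕ} (hn : n ≠ 0) : besselJ n 0 = 0 := by
  rw [besselJ_eq]
  simp [hn]

/-- In the region `z ≤ c n`, `c < 1`, the square of `J_n` grows at least like `z ^ κ`,
`κ = n √(1 - c²)`. -/
lemma mul_sq_besselJ_le {n : ℕ} (hn : n ≠ 0) {c κ : ℝ} (hc : 0 < c)
    (hκc : κ ^ 2 ≤ (n : ℝ) ^ 2 * (1 - c ^ 2)) {z : ℝ} (hz : 0 < z) (hzc : z ≤ c * n) :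
    κ * besselJ n z ^ 2 ≤ 2 * besselJ n z * besselT n z := by
  have hn0 : (0 : ℝ) < n := by exact_mod_cast Nat.pos_of_ne_zero hn
  have hcn : 0 < c * n := by positivity
  have hh : ∀ z : ℝ, z ≠ 0 → HasDerivAt (fun z => besselJ n z ^ 2)
      (2 * besselJ n z * besselT n z / z) z := fun z hz =>
    ((hasDerivAt_besselJ n hz).pow 2).congr_deriv (by push_cast; ring)
  have hS : ∀ z : ℝ, z ≠ 0 → HasDerivAt (fun z => 2 * besselJ n z * besselT n z)
      ((2 * besselT n z ^ 2 + 2 * ((n : ℝ) ^ 2 - z ^ 2) * besselJ n z ^ 2) / z) z := fun z hz =>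
    (((hasDerivAt_besselJ n hz).const_mul 2).mul (hasDerivAt_besselT n hz)).congr_deriv
      (by field_simp)
  have hF : ∀ z : ℝ, z ≠ 0 → HasDerivAt
      (fun z => (2 * besselJ n z * besselT n z) ^ 2 - κ ^ 2 * (besselJ n z ^ 2) ^ 2)
      (2 * (2 * besselJ n z * besselT n z) * ((2 * besselT n z ^ 2 +
        (2 * ((n : ℝ) ^ 2 - z ^ 2) - κ ^ 2) * besselJ n z ^ 2) / z)) z := fun z hz =>
    (((hS z hz).pow 2).sub (((hh z hz).pow 2).const_mul (κ ^ 2))).congr_deriv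
      (by push_cast; field_simp; ring)
  have hcJ := continuous_besselJ n
  have hcT := continuous_besselT n
  have hgap : ∀ x ∈ Set.Ioo 0 (c * n), κ ^ 2 ≤ (n : ℝ) ^ 2 - x ^ 2 := fun x hx => by
    have : x ^ 2 ≤ (c * n) ^ 2 := pow_le_pow_left₀ hx.1.le hx.2.le 2
    nlinarith
  have h0 : (0 : ℝ) ∈ Set.Icc 0 (c * n) := Set.left_mem_Icc.mpr hcn.le
  have hSmono : MonotoneOn (fun z => 2 * besselJ n z * besselT n z) (Set.Icc 0 (c * n)) := by
    refine monotoneOn_of_deriv_nonneg (convex_Icc _ _) (by fun_prop) ?_ ?_ <;>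
      rw [interior_Icc] <;> intro x hx
    · exact (hS x hx.1.ne').differentiableAt.differentiableWithinAt
    · rw [(hS x hx.1.ne').deriv]
      have := hgap x hx
      have : 0 ≤ (n : ℝ) ^ 2 - x ^ 2 := (sq_nonneg κ).trans this
      have := hx.1
      positivity
  have hSnn : ∀ x ∈ Set.Icc 0 (c * n), 0 ≤ 2 * besselJ n x * besselT n x := fun x hx => by
    have h := hSmono h0 hx hx.1
    simpa [besselJ_apply_zero hn] using h
  have hFmono : MonotoneOn
      (fun z => (2 * besselJ n z * besselT n z) ^ 2 - κ ^ 2 * (besselJ n z ^ 2) ^ 2)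
      (Set.Icc 0 (c * n)) := by
    refine monotoneOn_of_deriv_nonneg (convex_Icc _ _) (by fun_prop) ?_ ?_ <;>
      rw [interior_Icc] <;> intro x hx
    · exact (hF x hx.1.ne').differentiableAt.differentiableWithinAt
    · rw [(hF x hx.1.ne').deriv]
      have h1 := hgap x hx
      have h2 : 0 ≤ 2 * ((n : ℝ) ^ 2 - x ^ 2) - κ ^ 2 := by nlinarith [sq_nonneg κ]
      have h3 := hSnn x ⟨hx.1.le, hx.2.le⟩
      have h4 := hx.1
      exact mul_nonneg (mul_nonneg two_pos.le h3) (by positivity)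
  have hz' : z ∈ Set.Icc 0 (c * n) := ⟨hz.le, hzc⟩
  have h := hFmono h0 hz' hz.le
  simp only [besselJ_apply_zero hn] at h
  refine le_of_sq_le_sq ?_ (hSnn z hz')
  nlinarith

lemma sq_besselJ_growth {n : ℕ} (hn : n ≠ 0) {c κ : ℝ} (hc : 0 < c)
    (hκc : κ ^ 2 ≤ (n : ℝ) ^ 2 * (1 - c ^ 2)) {z l : ℝ} (hz : 0 < z) (hl : 1 ≤ l)
    (hzc : l * z ≤ c * n) : l ^ κ * besselJ n z ^ 2 ≤ besselJ n (l * z) ^ 2 := by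
  have hd : ∀ x : ℝ, 0 < x → HasDerivAt (fun x => besselJ n x ^ 2 * x ^ (-κ))
      ((2 * besselJ n x * besselT n x - κ * besselJ n x ^ 2) * x ^ (-κ - 1)) x := fun x hx => by
    refine (((hasDerivAt_besselJ n hx.ne').pow 2).mul
      (Real.hasDerivAt_rpow_const (p := -κ) (Or.inl hx.ne'))).congr_deriv ?_
    rw [Real.rpow_sub_one hx.ne']
    push_cast
    simp only [Pi.pow_apply]
    field_simp
    ring
  have hlz : z ≤ l * z := le_mul_of_one_le_left hz.le hl
  have hmono : MonotoneOn (fun x => besselJ n x ^ 2 * x ^ (-κ)) (Set.Icc z (l * z)) := by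
    refine monotoneOn_of_deriv_nonneg (convex_Icc _ _)
      (fun x hx => (hd x (hz.trans_le hx.1)).continuousAt.continuousWithinAt) ?_ ?_ <;>
      rw [interior_Icc] <;> intro x hx
    · exact (hd x (hz.trans hx.1)).differentiableAt.differentiableWithinAt
    · have hx0 := hz.trans hx.1
      rw [(hd x hx0).deriv]
      exact mul_nonneg (sub_nonneg.mpr
        (mul_sq_besselJ_le hn hc hκc hx0 (hx.2.le.trans hzc))) (Real.rpow_nonneg hx0.le _)
  have hl0 : 0 < l := one_pos.trans_le hl
  have h := hmono (Set.left_mem_Icc.mpr hlz) (Set.right_mem_Icc.mpr hlz) hlz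
  simp only [Real.mul_rpow hl0.le hz.le, Real.rpow_neg hl0.le] at h
  have hzk : 0 < z ^ (-κ) := Real.rpow_pos_of_pos hz _
  have hlk : 0 < l ^ κ := Real.rpow_pos_of_pos hl0 _
  rw [← mul_assoc] at h
  have hdiv := le_of_mul_le_mul_right h hzk
  rwa [← div_eq_mul_inv, le_div_iff₀ hlk, mul_comm] at hdiv

/-- Exponential growth of `|J_n|` under dilations inside `|z| ≤ c n`, `c < 1`. -/
lemma exists_besselJ_growth {c l : ℝ} (hc : 0 < c) (hc1 : c < 1) (hl : 1 < l) :
    ∃ L : ℝ, 1 < L ∧ ∀ n : ℕ, n ≠ 0 → ∀ z, 0 ≤ z → l * z ≤ c * n →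
      L ^ n * |besselJ n z| ≤ |besselJ n (l * z)| := by
  have hη : 0 < Real.sqrt (1 - c ^ 2) := Real.sqrt_pos.mpr (by nlinarith)
  have hη2 : Real.sqrt (1 - c ^ 2) ^ 2 = 1 - c ^ 2 := Real.sq_sqrt (by nlinarith)
  set η := Real.sqrt (1 - c ^ 2)
  refine ⟨l ^ (η / 2), Real.one_lt_rpow hl (by positivity), fun n hn z hz hzc => ?_⟩
  rcases hz.eq_or_lt with rfl | hz
  · simp [besselJ_apply_zero hn]
  have h := sq_besselJ_growth hn hc (κ := n * η)
    (by rw [mul_pow, hη2]) hz hl.le hzc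
  have hl0 : 0 < l := one_pos.trans hl
  refine abs_le_of_sq_le_sq' ?_ (abs_nonneg _) |>.2
  rw [mul_pow, sq_abs, sq_abs, ← Real.rpow_natCast, ← Real.rpow_natCast, ← Real.rpow_mul hl0.le,
    ← Real.rpow_mul hl0.le]
  have e : η / 2 * n * (2 : ℕ) = n * η := by push_cast; ring
  rwa [e]

lemma measurable_mode (bc : BoundaryCondition) (R : ℝ) (n k : ℕ) (a b : ℝ) :
    Measurable (mode bc R n k a b) := by
  have h1 := (continuous_besselJ n).measurable
  have h2 := Complex.measurable_arg
  unfold mode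
  fun_prop

lemma lpNormOn_mode_ne_top (bc : BoundaryCondition) {R : ℝ} (hR : 0 < R) (n : ℕ) {k : ℕ}
    (hk : 1 ≤ k) (a b : ℝ) (p : ℝ≥0∞) :
    lpNormOn p (disk R) (mode bc R n k a b) ≠ ∞ := by
  have hα := alpha_pos bc hR n hk
  obtain ⟨C, hC⟩ := isCompact_Icc.exists_bound_of_continuousOn
    (s := Set.Icc 0 (alpha bc R n k)) (continuous_besselJ n).continuousOn
  have : IsFiniteMeasure (volume.restrict (disk R) : Measure ℂ) :=
    ⟨by rw [Measure.restrict_apply_univ]; exact measure_ball_lt_top⟩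
  refine (MemLp.of_bound (measurable_mode bc R n k a b).aestronglyMeasurable
    (C * (|a| + |b|)) ?_).eLpNorm_lt_top.ne
  refine (ae_restrict_iff' measurableSet_ball).mpr (Eventually.of_forall fun x hx => ?_)
  have hx' : ‖x‖ < R := by simpa using hx
  have h1 := hC (alpha bc R n k * ‖x‖ / R) ⟨by positivity, by
    rw [div_le_iff₀ hR]; gcongr⟩
  rw [mode, norm_mul]
  refine mul_le_mul h1 ?_ (norm_nonneg _) ((norm_nonneg _).trans h1)
  rw [Real.norm_eq_abs]
  refine (abs_add_le _ _).trans ?_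
  rw [abs_mul, abs_mul]
  gcongr
  · exact mul_le_of_le_one_right (abs_nonneg _) (Real.abs_cos_le_one _)
  · exact mul_le_of_le_one_right (abs_nonneg _) (Real.abs_sin_le_one _)

lemma Nontriv.exists_angle {n : ℕ} {a b : ℝ} (h : Nontriv n a b) :
    ∃ φ : ℝ, -Real.pi < φ ∧ φ < Real.pi ∧ a * Real.cos (n * φ) + b * Real.sin (n * φ) ≠ 0 := by
  have hπ := Real.pi_pos
  by_cases ha : a = 0
  · obtain ⟨hn, hb⟩ := h.resolve_left (not_not.mpr ha)
    have hn0 : (1 : ℝ) ≤ n := by exact_mod_cast Nat.one_le_iff_ne_zero.mpr hn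
    have e : (n : ℝ) * (Real.pi / 2 / n) = Real.pi / 2 := by field_simp
    have hle : Real.pi / 2 / n ≤ Real.pi / 2 := div_le_self (by positivity) hn0
    have h0 : 0 ≤ Real.pi / 2 / n := by positivity
    exact ⟨Real.pi / 2 / n, by linarith, by linarith, by simp [e, ha, hb]⟩
  · exact ⟨0, by linarith, hπ, by simpa using ha⟩

lemma lpNormOn_mode_ne_zero (bc : BoundaryCondition) {R : ℝ} (hR : 0 < R) (n : ℕ) {k : ℕ}
    (hk : 1 ≤ k) {a b : ℝ} (hab : Nontriv n a b) {p : ℝ≥0∞} (hp : p ≠ 0) :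
    lpNormOn p (disk R) (mode bc R n k a b) ≠ 0 := by
  have hα := alpha_pos bc hR n hk
  intro h0
  rw [lpNormOn, eLpNorm_eq_zero_iff (measurable_mode bc R n k a b).aestronglyMeasurable hp] at h0
  have hUo : IsOpen (disk R ∩ Complex.slitPlane) :=
    Metric.isOpen_ball.inter Complex.isOpen_slitPlane
  have hae := ae_mono (Measure.restrict_mono
    (Set.inter_subset_left : disk R ∩ Complex.slitPlane ⊆ disk R) le_rfl) h0
  have hcont : ContinuousOn (mode bc R n k a b) (disk R ∩ Complex.slitPlane) := by
    intro x hx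
    have h1 := Complex.continuousAt_arg hx.2
    have h2 : ContinuousAt (fun x : ℂ => besselJ n (alpha bc R n k * ‖x‖ / R)) x := by
      have := continuous_besselJ n
      fun_prop
    unfold mode
    exact (ContinuousAt.mul h2 (by fun_prop)).continuousWithinAt
  have hzero := Measure.eqOn_open_of_ae_eq hae hUo hcont continuousOn_const
  obtain ⟨φ, hφ1, hφ2, hφ⟩ := hab.exists_angle
  obtain ⟨z, hz, hz0, hzα⟩ := ((eventually_besselJ_pos n).and (Ioo_mem_nhdsGT hα)).exists
  set r := z * R / alpha bc R n k with hr
  have hr0 : 0 < r := by positivity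
  set x : ℂ := r * (Complex.cos φ + Complex.sin φ * Complex.I) with hx
  have harg : x.arg = φ := Complex.arg_mul_cos_add_sin_mul_I hr0 ⟨hφ1, hφ2.le⟩
  have hnorm : ‖x‖ = r := by
    rw [hx, norm_mul, Complex.norm_cos_add_sin_mul_I, mul_one, Complex.norm_real,
      Real.norm_of_nonneg hr0.le]
  have hxU : x ∈ disk R ∩ Complex.slitPlane := by
    refine ⟨?_, ?_⟩
    · rw [disk, mem_ball_zero_iff, hnorm, hr, div_lt_iff₀ hα, mul_comm]
      gcongr
    · rw [Complex.mem_slitPlane_iff_arg]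
      refine ⟨by rw [harg]; exact hφ2.ne, ?_⟩
      rw [← norm_pos_iff, hnorm]
      exact hr0
  have h := hzero hxU
  have e : alpha bc R n k * r / R = z := by rw [hr]; field_simp
  rw [mode, harg, hnorm, e] at h
  exact mul_ne_zero hz.ne' hφ h

lemma eLpNorm_comp_smul_le {u : ℂ → ℝ} (hu : Measurable u) {V D : Set ℂ} (hD : MeasurableSet D)
    {l : ℝ} (hl : 1 ≤ l) (hV : ∀ x ∈ V, l • x ∈ D) (p : ℝ≥0∞) :
    eLpNorm (fun x => u (l • x)) p (volume.restrict V) ≤ eLpNorm u p (volume.restrict D) := by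
  have hm : Measurable fun x : ℂ => l • x := measurable_const_smul l
  have h1 := eLpNorm_map_measure (p := p) (μ := volume.restrict V) (f := fun x : ℂ => l • x)
    hu.aestronglyMeasurable hm.aemeasurable
  rw [show (fun x => u (l • x)) = u ∘ fun x : ℂ => l • x from rfl, ← h1]
  refine eLpNorm_mono_measure _ ?_
  calc Measure.map (fun x : ℂ => l • x) (volume.restrict V)
      ≤ Measure.map (fun x : ℂ => l • x) (volume.restrict ((fun x : ℂ => l • x) ⁻¹' D)) :=
        Measure.map_mono (Measure.restrict_mono hV le_rfl) hm
    _ = (Measure.map (fun x : ℂ => l • x) volume).restrict D := (Measure.restrict_map hm hD).symm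
    _ ≤ volume.restrict D := by
        refine Measure.restrict_mono le_rfl ?_
        rw [Measure.map_addHaar_smul _ (by positivity)]
        refine Measure.le_iff.mpr fun s _ => ?_
        rw [Measure.smul_apply, smul_eq_mul]
        refine mul_le_of_le_one_left zero_le ?_
        rw [ENNReal.ofReal_le_one, abs_of_nonneg (by positivity)]
        exact inv_le_one_of_one_le₀ (one_le_pow₀ hl)

lemma exists_subset_closedBall {R : ℝ} (hR : 0 < R) {V : Set ℂ} (hVD : V ⊆ disk R)
    (hVc : closure V ∩ frontier (disk R) = ∅) :
    ∃ ρ, 0 < ρ ∧ ρ < R ∧ ∀ x ∈ V, ‖x‖ ≤ ρ := by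
  have hcl : closure V ⊆ Metric.ball 0 R := by
    intro x hx
    have h1 : x ∈ Metric.closedBall (0 : ℂ) R :=
      closure_ball (0 : ℂ) hR.ne' ▸ closure_mono hVD hx
    by_contra h2
    have h3 : x ∈ frontier (disk R) := by
      rw [disk, frontier_ball (0 : ℂ) hR.ne', ← Metric.closedBall_sdiff_ball]
      exact ⟨h1, h2⟩
    exact Set.notMem_empty x (hVc ▸ ⟨hx, h3⟩)
  obtain ⟨ρ, hρ, hsub⟩ := exists_pos_lt_subset_ball hR isClosed_closure hcl
  exact ⟨ρ, hρ.1, hρ.2, fun x hx => by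
    simpa using (Metric.mem_ball.mp (hsub (subset_closure hx))).le⟩

lemma tendsto_ratio (bc : BoundaryCondition) {R : ℝ} (hR : 0 < R) (p : ℝ≥0∞) {V : Set ℂ}
    (hVo : IsOpen V) (hVD : V ⊆ disk R) (hVc : closure V ∩ frontier (disk R) = ∅)
    (a b : ℕ → ℝ) {k : ℕ} (hk : 1 ≤ k) :
    Tendsto (fun n : ℕ => ratio p R V (mode bc R n k (a n) (b n))) atTop (𝓝 0) := by
  obtain ⟨ρ, hρ0, hρR, hVρ⟩ := exists_subset_closedBall hR hVD hVc
  obtain ⟨ρ₁, hρ₁, hρ₁R⟩ := exists_between hρR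
  obtain ⟨A, hA1, hAR⟩ := exists_between ((one_lt_div (hρ0.trans hρ₁)).mpr hρ₁R)
  have hρ₁0 := hρ0.trans hρ₁
  have hl : 1 < ρ₁ / ρ := (one_lt_div hρ0).mpr hρ₁
  have hc0 : 0 < A * ρ₁ / R := by positivity
  have hc1 : A * ρ₁ / R < 1 := by
    rw [div_lt_one hR]
    rwa [lt_div_iff₀ hρ₁0] at hAR
  set l := ρ₁ / ρ with hldef
  have hlρ : l * ρ = ρ₁ := by rw [hldef]; field_simp
  obtain ⟨L, hL, hgrow⟩ := exists_besselJ_growth hc0 hc1 hl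
  have hbound : ∀ᶠ n : ℕ in atTop,
      ratio p R V (mode bc R n k (a n) (b n)) ≤ (ENNReal.ofReal L⁻¹) ^ n := by
    filter_upwards [eventually_alpha_le bc hR k hk hA1, eventually_ne_atTop 0] with n hn hn0
    have hα := alpha_pos bc hR n hk
    refine ENNReal.div_le_of_le_mul ?_
    refine le_trans ?_ (mul_le_mul_right (eLpNorm_comp_smul_le (V := V)
      (measurable_mode bc R n k (a n) (b n)) measurableSet_ball hl.le (fun x hx => ?_) p) _)
    · rw [← ENNReal.ofReal_pow (by positivity)]
      refine eLpNorm_le_mul_eLpNorm_of_ae_le_mul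
        ((ae_restrict_iff' hVo.measurableSet).mpr (Eventually.of_forall fun x hx => ?_)) p
      have hl0 : 0 < l := one_pos.trans hl
      have hx' := hVρ x hx
      have hg := hgrow n hn0 (alpha bc R n k * ‖x‖ / R) (by positivity) (by
        calc l * (alpha bc R n k * ‖x‖ / R) ≤ l * (A * n * ρ / R) := by gcongr
          _ = A * (l * ρ) / R * n := by ring
          _ = A * ρ₁ / R * n := by rw [hlρ])
      have harg : (l • x).arg = x.arg := by
        rw [Complex.real_smul, Complex.arg_real_mul _ hl0]
      have hnorm : ‖l • x‖ = l * ‖x‖ := by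
        rw [norm_smul, Real.norm_of_nonneg hl0.le]
      rw [mode, mode, harg, hnorm, norm_mul, norm_mul, Real.norm_eq_abs, ← mul_assoc,
        Real.norm_eq_abs (besselJ _ _)]
      refine mul_le_mul_of_nonneg_right ?_ (norm_nonneg _)
      rw [inv_pow, inv_mul_eq_div, le_div_iff₀ (by positivity), mul_comm]
      rwa [show alpha bc R n k * (l * ‖x‖) / R = l * (alpha bc R n k * ‖x‖ / R) by ring]
    · rw [mem_ball_zero_iff, norm_smul, Real.norm_of_nonneg (by positivity)]
      calc l * ‖x‖ ≤ l * ρ := by have := hVρ x hx; gcongr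
        _ < R := by rw [hlρ]; exact hρ₁R
  refine tendsto_of_tendsto_of_tendsto_of_le_of_le' tendsto_const_nhds
    (ENNReal.tendsto_pow_atTop_nhds_zero_of_lt_one ?_)
    (Eventually.of_forall fun _ => zero_le) hbound
  rw [ENNReal.ofReal_lt_one]
  exact inv_lt_one_of_one_lt₀ hL

end DiskModes

/-- The coefficients `a n k`, `b n k` pick, for each `n` and `k`, an arbitrary eigenfunction `u_{nk}`.
The first clause says that the ratios are quotients by positive finite numbers. -/
theorem corollary2p2 (R : ℝ) (hR : 0 < R) (bc : DiskModes.BoundaryCondition)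
    (p : ℝ≥0∞) (hp : 1 ≤ p) (V : Set ℂ) (hVo : IsOpen V) (hVD : V ⊆ DiskModes.disk R)
    (hVc : closure V ∩ frontier (DiskModes.disk R) = ∅) :
    (∀ a b : ℕ → ℕ → ℝ, (∀ n k, DiskModes.Nontriv n (a n k) (b n k)) →
      (∀ n k : ℕ, 1 ≤ k →
        DiskModes.lpNormOn p (DiskModes.disk R) (DiskModes.mode bc R n k (a n k) (b n k)) ≠ 0 ∧
        DiskModes.lpNormOn p (DiskModes.disk R) (DiskModes.mode bc R n k (a n k) (b n k)) ≠ ∞) ∧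
      (∀ k : ℕ, 1 ≤ k →
        Tendsto (fun n : ℕ => DiskModes.ratio p R V (DiskModes.mode bc R n k (a n k) (b n k)))
          atTop (𝓝 0)) ∧
      (⨅ (n : ℕ) (k : ℕ) (_ : 1 ≤ k),
        DiskModes.ratio p R V (DiskModes.mode bc R n k (a n k) (b n k))) = 0) ∧
    DiskModes.Cp bc p R V = 0 := by
  have hlim := fun (a b : ℕ → ℝ) (k : ℕ) (hk : 1 ≤ k) =>
    DiskModes.tendsto_ratio bc hR p hVo hVD hVc a b hk
  refine ⟨fun a b hab => ⟨fun n k hk => ⟨?_, ?_⟩, fun k hk => ?_, ?_⟩, ?_⟩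
  · exact DiskModes.lpNormOn_mode_ne_zero bc hR n hk (hab n k) (zero_lt_one.trans_le hp).ne'
  · exact DiskModes.lpNormOn_mode_ne_top bc hR n hk _ _ p
  · exact hlim (fun n => a n k) (fun n => b n k) k hk
  · exact le_antisymm (ge_of_tendsto' (hlim (fun n => a n 1) (fun n => b n 1) 1 le_rfl) fun n =>
      iInf_le_of_le n (iInf₂_le 1 le_rfl)) zero_le
  · exact le_antisymm (ge_of_tendsto' (hlim (fun _ => 1) (fun _ => 0) 1 le_rfl) fun n =>
      sInf_le ⟨n, 1, 1, 0, le_rfl, Or.inl one_ne_zero, rfl⟩) zero_le
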